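/- Let $d\ge 0$ and let $a_1,\dots,a_d\in\mathbb{C}$ satisfy $\sum_{i=1}^d|a_i|\le 1$. Then the polynomial $p(z_1,\dots,z_d)=1-\sum_{i=1}^d a_iz_i$ is an Agler denominator. Here, for $p\in\mathbb{C}[z_1,\dots,z_d]$, let $\deg p=(\deg_1p,\dots,\deg_dp)$, where $\deg_i p$ is the degree of $p$ in $z_i$, let $\bar p(z)=\overline{p(\bar z)}$, and let $1/z=(1/z_1,\dots,1/z_d)$, so that $z^{\deg p}\,\bar p(1/z)$ is a polynomial. The polynomial $p$ is an *Agler denominator* if it has no zeros in the open polydisk $\mathbb{D}^d$ and the rational function $$f(z)=\frac{z^{\deg p}\,\bar p(1/z)}{p(z)}$$ belongs to the Schur–Agler class, that is, $f$ is analytic on $\mathbb{D}^d$ and, if $f(z)=\sum_{r\in\mathbb{N}_0^d}c_rz^r$ is its power series on $\mathbb{D}^d$, the series $f(T)=\sum_r c_rT_1^{r_1}\cdots T_d^{r_d}$ converges in operator norm and satisfies $\|f(T)\|\le 1$ for every $d$-tuple $T=(T_1,\dots,T_d)$ of pairwise commuting operators with $\|T_i\|<1$ on a common complex Hilbert space.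 -/

import Mathlib

open scoped ComplexConjugate

universe u

noncomputable section

namespace AglerDen

/-- The open unit polydisk `𝔻^d` in `ℂ^d`. -/
def polydisk (d : ℕ) : Set (Fin d → ℂ) := {z | ∀ i, ‖z i‖ < 1}

/-- A `d`-variable polynomial is semi-stable if it has no zeros in the open polydisk. -/
def IsSemiStable {d : ℕ} (p : MvPolynomial (Fin d) ℂ) : Prop :=
  ∀ z ∈ polydisk d, MvPolynomial.eval z p ≠ 0

/-- The multi-degree `deg p = (deg_1 p, …, deg_d p)`, where `deg_i p` is the degree of `p` as a
polynomial in `z_i`. -/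
def multiDegree {d : ℕ} (p : MvPolynomial (Fin d) ℂ) : Fin d →₀ ℕ :=
  Finsupp.equivFunOnFinite.symm fun i => p.degreeOf i

/-- The polynomial `z^n p̄(1/z)`, for `n ≥ deg p`, where `p̄(z) = conj (p (conj z))`: if
`p = ∑ p_k z^k`, it is `∑ conj(p_k) z^(n-k)`. -/
def reflection {d : ℕ} (n : Fin d →₀ ℕ) (p : MvPolynomial (Fin d) ℂ) : MvPolynomial (Fin d) ℂ :=
  ∑ k ∈ p.support, MvPolynomial.monomial (n - k) (conj (p.coeff k))

/-- The defining identity of `reflection`, at points with nonzero coordinates. -/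
theorem eval_reflection {d : ℕ} (n : Fin d →₀ ℕ) (p : MvPolynomial (Fin d) ℂ)
    (hn : multiDegree p ≤ n) (z : Fin d → ℂ) (hz : ∀ i, z i ≠ 0) :
    MvPolynomial.eval z (reflection n p) =
      (∏ i, z i ^ n i) * conj (MvPolynomial.eval (fun i => conj (1 / z i)) p) := by
  rw [reflection, map_sum, MvPolynomial.eval_eq', map_sum, Finset.mul_sum]
  refine Finset.sum_congr rfl fun k hk => ?_
  rw [MvPolynomial.eval_monomial, Finsupp.prod_fintype _ _ (by simp), map_mul, map_prod,
    mul_left_comm, ← Finset.prod_mul_distrib]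
  congr 1
  refine Finset.prod_congr rfl fun i _ => ?_
  have h : k i ≤ n i :=
    (MvPolynomial.monomial_le_degreeOf i hk).trans (by simpa [multiDegree] using hn i)
  simp only [map_pow, Complex.conj_conj, Finsupp.coe_tsub, Pi.sub_apply]
  rw [pow_sub₀ _ (hz i) h, one_div, inv_pow]

/-- The monomial `T^r = T_1^{r_1} ⋯ T_d^{r_d}` in a `d`-tuple of operators. -/
def opMonomial {d : ℕ} {H : Type*} [NormedAddCommGroup H] [InnerProductSpace ℂ H]
    (T : Fin d → H →L[ℂ] H) (r : Fin d →₀ ℕ) : H →L[ℂ] H :=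
  (List.ofFn fun i => T i ^ r i).prod

/-- The power series `∑ c_r z^r` converges to `f` on the open polydisk. -/
def HasSeriesOnPolydisk {d : ℕ} (f : (Fin d → ℂ) → ℂ) (c : MvPowerSeries (Fin d) ℂ) : Prop :=
  ∀ z ∈ polydisk d, HasSum (fun r : Fin d →₀ ℕ => MvPowerSeries.coeff r c * ∏ i, z i ^ r i) (f z)

/-- The scalar Schur–Agler class `𝒮𝒜_d`: `f` is analytic on the open polydisk, and, if
`f(z) = ∑ c_r z^r` is its (unique) power series there, then `f(T) = ∑ c_r T^r` converges in
operator norm with `‖f(T)‖ ≤ 1` for every `d`-tuple `T` of commuting strict contractions on a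
common complex Hilbert space. -/
def IsSchurAgler {d : ℕ} (f : (Fin d → ℂ) → ℂ) : Prop :=
  AnalyticOnNhd ℂ f (polydisk d) ∧
  ∃ c : MvPowerSeries (Fin d) ℂ, HasSeriesOnPolydisk f c ∧
    ∀ (H : Type u) [NormedAddCommGroup H] [InnerProductSpace ℂ H] [CompleteSpace H]
      (T : Fin d → H →L[ℂ] H), (∀ i j, Commute (T i) (T j)) → (∀ i, ‖T i‖ < 1) →
      ∃ A : H →L[ℂ] H,
        HasSum (fun r : Fin d →₀ ℕ => MvPowerSeries.coeff r c • opMonomial T r) A ∧ ‖A‖ ≤ 1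

/-- A polynomial `p` is an Agler denominator if it is semi-stable and the rational function
`z^{deg p} p̄(1/z) / p(z)` is in the Schur–Agler class. -/
def IsAglerDenominator {d : ℕ} (p : MvPolynomial (Fin d) ℂ) : Prop :=
  IsSemiStable p ∧
  IsSchurAgler.{u} fun z : Fin d → ℂ =>
    MvPolynomial.eval z (reflection (multiDegree p) p) / MvPolynomial.eval z p

end AglerDen

end

/-! Write `p̃` for the numerator. The heart is the estimate `‖p̃(T)h‖ ≤ ‖p(T)h‖` for commuting
contractions, obtained from determinants. Choose `uᵢ² = aᵢ`, put `s = ∑|aᵢ| < 1` and `D = diag(Tᵢ)`,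
and let `K` be the rank-one matrix with entries `ūᵢūⱼ`, of norm `s`. The Möbius map of the operator
ball with parameter `K` has numerator `B = (1 - KK*)^(-1/2)(D - K)` and denominator `C = (1 -
K*K)^(-1/2)(1 - K*D)`, and `‖Cy‖² - ‖By‖² = ‖y‖² - ‖Dy‖² ≥ 0`. With `m = (1 - s²)^(-1/2)`, `det B =
m p̃(T)` and `det C = m p(T)`. Domination passes to determinants (`norm_det_smul_le`): apply `B` and
`C` in every slot of an `n`-fold tensor power, where commutativity lets one slot be exchanged at a
time, and evaluate on an antisymmetric tensor. The case `s = 1` is a limit. Finally, `1/p` has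
coefficients bounded by 1, so its series converges at strict contractions to some `E` with `p(T)E =
1`. Then `f(T) = p̃(T)E` and `‖p̃(T)Eh‖ ≤ ‖p(T)Eh‖ = ‖h‖`. -/

noncomputable section

namespace AglerDen

open Finset

/-! ### Determinants over a commutative ring acting on a normed space. -/

section Determinant

variable {n : Type*} [Fintype n] [DecidableEq n]

/-- Averaging over one coordinate of an index tuple. -/
theorem sum_sum_update (k : n) (g : (n → n) → ℝ) :
    ∑ σ : n → n, ∑ i, g (Function.update σ k i) = Fintype.card n * ∑ σ, g σ := by
  have e : ∑ x : (n → n) × n, g (Function.update x.1 k x.2) = ∑ x : (n → n) × n, g x.1 := by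
    -- Exchanging the new value with the overwritten one is an involution.
    refine Finset.sum_nbij' (fun x => (Function.update x.1 k x.2, x.1 k))
      (fun x => (Function.update x.1 k x.2, x.1 k)) ?_ ?_ ?_ ?_ ?_ <;> simp
  rw [Fintype.sum_prod_type, Fintype.sum_prod_type] at e
  rw [e]
  simp [Finset.mul_sum]

variable {R H : Type*} [CommRing R] [NormedAddCommGroup H] [Module R H]

/-- The operator `M k` acting on the `k`-th tensor slot, for all `k` simultaneously. -/
def slotAction (M : n → Matrix n n R) (f : (n → n) → H) (σ : n → n) : H :=
  ∑ τ : n → n, (∏ l, M l (σ l) (τ l)) • f τ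

/-- The entries commute, so the operator in slot `k` can be applied last, after the identity has
held its place. -/
theorem slotAction_update (M : n → Matrix n n R) (f : (n → n) → H) (k : n) (B : Matrix n n R)
    (σ : n → n) (i : n) :
    slotAction (Function.update M k B) f (Function.update σ k i) =
      ∑ j, B i j • slotAction (Function.update M k 1) f (Function.update σ k j) := by
  have key : ∀ (B : Matrix n n R) (i : n) (τ : n → n),
      (∏ l, Function.update M k B l (Function.update σ k i l) (τ l)) =
        B i (τ k) * ∏ l ∈ univ.erase k, M l (σ l) (τ l) := by
    intro B i τ
    rw [← Finset.mul_prod_erase univ _ (mem_univ k)]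
    congr 1
    · simp
    · refine Finset.prod_congr rfl fun l hl => ?_
      simp [Function.update_of_ne (Finset.ne_of_mem_erase hl)]
  have key' : ∀ (B : Matrix n n R) (i : n),
      slotAction (Function.update M k B) f (Function.update σ k i) =
        ∑ τ : n → n, (B i (τ k) * ∏ l ∈ univ.erase k, M l (σ l) (τ l)) • f τ :=
    fun B i => Finset.sum_congr rfl fun τ _ => by rw [key]
  simp_rw [key', Finset.smul_sum]
  rw [Finset.sum_comm]
  refine Finset.sum_congr rfl fun τ _ => ?_
  rw [Finset.sum_eq_single (τ k)]
  · simp [mul_smul]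
  · intro j _ hj
    simp [Matrix.one_apply_ne hj]
  · simp

theorem sum_norm_slotAction_update_le (M : n → Matrix n n R) (f : (n → n) → H) (k : n)
    {B C : Matrix n n R}
    (hBC : ∀ y : n → H, ∑ i, ‖∑ j, B i j • y j‖ ^ 2 ≤ ∑ i, ‖∑ j, C i j • y j‖ ^ 2) :
    ∑ σ, ‖slotAction (Function.update M k B) f σ‖ ^ 2 ≤
      ∑ σ, ‖slotAction (Function.update M k C) f σ‖ ^ 2 := by
  have hn : (0 : ℝ) < Fintype.card n := by
    have : Nonempty n := ⟨k⟩
    exact_mod_cast Fintype.card_pos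
  refine le_of_mul_le_mul_left ?_ hn
  rw [← sum_sum_update k (fun σ => ‖slotAction (Function.update M k B) f σ‖ ^ 2),
    ← sum_sum_update k (fun σ => ‖slotAction (Function.update M k C) f σ‖ ^ 2)]
  refine Finset.sum_le_sum fun σ _ => ?_
  -- Freeze all coordinates except the `k`-th; what remains is a vector indexed by `n`, to which the
  -- domination applies.
  have h := hBC fun j => slotAction (Function.update M k 1) f (Function.update σ k j)
  simp only [← slotAction_update M f k] at h
  exact h

theorem sum_norm_slotAction_const_le (f : (n → n) → H) {B C : Matrix n n R}
    (hBC : ∀ y : n → H, ∑ i, ‖∑ j, B i j • y j‖ ^ 2 ≤ ∑ i, ‖∑ j, C i j • y j‖ ^ 2) :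
    ∑ σ, ‖slotAction (fun _ => B) f σ‖ ^ 2 ≤ ∑ σ, ‖slotAction (fun _ => C) f σ‖ ^ 2 := by
  have key : ∀ s : Finset n, ∑ σ, ‖slotAction (fun _ => B) f σ‖ ^ 2 ≤
      ∑ σ, ‖slotAction (fun l => if l ∈ s then C else B) f σ‖ ^ 2 := by
    intro s
    induction s using Finset.induction_on with
    | empty => simp
    | insert k s hk ih =>
      refine ih.trans ?_
      have h := sum_norm_slotAction_update_le (fun l => if l ∈ s then C else B) f k hBC
      have e1 : Function.update (fun l => if l ∈ s then C else B) k B =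
          fun l => if l ∈ s then C else B := by
        simp [hk]
      have e2 : Function.update (fun l => if l ∈ s then C else B) k C =
          fun l => if l ∈ insert k s then C else B := by
        ext1 l
        rcases eq_or_ne l k with rfl | hl <;> simp [*]
      rwa [e1, e2] at h
  simpa using key univ

/-- The antisymmetric tensor `∑_π sign(π) e_{π 1} ⊗ ⋯ ⊗ e_{π n} ⊗ h`. -/
def antisymmTensor (R : Type*) [CommRing R] [Module R H] (h : H) (τ : n → n) : H :=
  ∑ π : Equiv.Perm n, if ⇑π = τ then ((Equiv.Perm.sign π : ℤ) : R) • h else 0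

theorem slotAction_antisymmTensor (B : Matrix n n R) (h : H) (σ : n → n) :
    slotAction (fun _ => B) (antisymmTensor R h) σ = (B.submatrix σ id).det • h := by
  simp only [slotAction, antisymmTensor, Finset.smul_sum]
  rw [Finset.sum_comm, ← Matrix.det_transpose, Matrix.det_apply', Finset.sum_smul]
  refine Finset.sum_congr rfl fun π _ => ?_
  rw [Finset.sum_eq_single ⇑π]
  · simp [smul_smul, mul_comm]
  · intro τ _ hτ
    simp [hτ.symm]
  · simp

/-- A repeated row kills the determinant and a permutation of rows only changes its sign, so the sum
is `n!` equal terms. The same factor occurs for `B` and `C` and cancels. -/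
theorem sum_norm_det_submatrix (B : Matrix n n R) (h : H) :
    ∑ σ : n → n, ‖(B.submatrix σ id).det • h‖ ^ 2 =
      (∑ σ : n → n, if Function.Bijective σ then 1 else 0) * ‖B.det • h‖ ^ 2 := by
  classical
  rw [Finset.sum_mul]
  refine Finset.sum_congr rfl fun σ _ => ?_
  split_ifs with hσ
  · have e := Matrix.det_permute (Equiv.ofBijective σ hσ) B
    rw [Equiv.coe_ofBijective] at e
    rw [e, one_mul]
    rcases Int.units_eq_one_or (Equiv.Perm.sign (Equiv.ofBijective σ hσ)) with h1 | h1 <;>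
      simp [h1]
  · have : ¬ Function.Injective σ := fun h => hσ (Finite.injective_iff_bijective.1 h)
    simp only [Function.Injective, not_forall] at this
    obtain ⟨i, j, hij, hne⟩ := this
    rw [Matrix.det_zero_of_row_eq hne]
    · simp
    · ext l; simp [hij]

/-- Determinants of matrices over a commuting family respect domination of the block operators. -/
theorem norm_det_smul_le {B C : Matrix n n R}
    (hBC : ∀ y : n → H, ∑ i, ‖∑ j, B i j • y j‖ ^ 2 ≤ ∑ i, ‖∑ j, C i j • y j‖ ^ 2) (h : H) :
    ‖B.det • h‖ ≤ ‖C.det • h‖ := by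
  classical
  have key := sum_norm_slotAction_const_le (antisymmTensor R h) hBC
  simp only [slotAction_antisymmTensor, sum_norm_det_submatrix] at key
  have hpos : (0 : ℝ) < ∑ σ : n → n, if Function.Bijective σ then 1 else 0 := by
    refine Finset.sum_pos' (fun σ _ => by split_ifs <;> norm_num) ⟨id, mem_univ _, ?_⟩
    simp
  exact (sq_le_sq₀ (norm_nonneg _) (norm_nonneg _)).1 (le_of_mul_le_mul_left key hpos)

theorem det_diagonal_add_vecMulVec_of_field {K : Type*} [Field K] (z c b : n → K)
    (hz : ∀ i, z i ≠ 0) :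
    (Matrix.diagonal z + Matrix.vecMulVec c b).det =
      ∏ i, z i + ∑ i, c i * b i * ∏ j ∈ univ.erase i, z j := by
  have e : Matrix.diagonal z + Matrix.vecMulVec c b =
      Matrix.diagonal z * (1 + Matrix.replicateCol Unit (fun i => c i / z i) *
        Matrix.replicateRow Unit b) := by
    ext i j
    have := hz i
    simp only [Matrix.add_apply, Matrix.vecMulVec_apply, Matrix.diagonal_mul,
      Matrix.mul_apply (M := Matrix.replicateCol _ _), Matrix.replicateCol_apply,
      Matrix.replicateRow_apply, Finset.univ_unique, Finset.sum_singleton, Matrix.diagonal_apply,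
      Matrix.one_apply]
    split_ifs
    · field_simp
    · field_simp
      simp
  rw [e, Matrix.det_mul, Matrix.det_one_add_replicateCol_mul_replicateRow, Matrix.det_diagonal,
    mul_add, mul_one, dotProduct, Finset.mul_sum]
  congr 1
  refine Finset.sum_congr rfl fun i _ => ?_
  have := hz i
  rw [← Finset.mul_prod_erase univ _ (mem_univ i)]
  field_simp

/-- The matrix determinant lemma needs `1 / zᵢ`, hence the passage to the fraction field of a
domain. -/
theorem det_diagonal_add_vecMulVec [IsDomain R] (z c b : n → R) (hz : ∀ i, z i ≠ 0) :
    (Matrix.diagonal z + Matrix.vecMulVec c b).det =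
      ∏ i, z i + ∑ i, c i * b i * ∏ j ∈ univ.erase i, z j := by
  have hinj := IsFractionRing.injective R (FractionRing R)
  apply hinj
  have h := det_diagonal_add_vecMulVec_of_field (fun i => algebraMap R (FractionRing R) (z i))
    (fun i => algebraMap R (FractionRing R) (c i)) (fun i => algebraMap R (FractionRing R) (b i))
    fun i => (map_ne_zero_iff _ hinj).2 (hz i)
  simp only [map_add, map_sum, map_mul, map_prod]
  rw [RingHom.map_det, ← h]
  congr 1
  ext i j
  simp [Matrix.vecMulVec_apply, Matrix.diagonal_apply, apply_ite]

end Determinant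

/-! ### The Möbius transformation and the norm inequality. -/

section Domination

variable {n H : Type*} [Fintype n] [NormedAddCommGroup H] [InnerProductSpace ℂ H]

theorem sum_norm_sq_add_smul (u : n → ℂ) (z : n → H) (w : H) :
    ∑ i, ‖z i + conj (u i) • w‖ ^ 2 =
      ∑ i, ‖z i‖ ^ 2 + 2 * (inner ℂ (∑ i, u i • z i) w).re + (∑ i, ‖u i‖ ^ 2) * ‖w‖ ^ 2 := by
  rw [sum_inner, Complex.re_sum, Finset.mul_sum, Finset.sum_mul, ← Finset.sum_add_distrib,
    ← Finset.sum_add_distrib]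
  refine Finset.sum_congr rfl fun i _ => ?_
  have h := norm_add_sq (𝕜 := ℂ) (z i) (conj (u i) • w)
  rw [inner_smul_right, norm_smul, RCLike.norm_conj, mul_pow] at h
  rw [h, inner_smul_left]
  rfl

/-- Expanded, each side is a quadratic form in `α` and `ζ`; the conditions on `m` and `t` give `2t +
st² = sm²`, which makes the form symmetric. -/
theorem re_inner_add_norm_sq_swap {s t m : ℝ} (hm : m = 1 + t * s) (hs : m ^ 2 * (1 - s ^ 2) = 1)
    (hs0 : s ≠ 0) (α ζ : H) :
    2 * (inner ℂ ζ ((t : ℂ) • ζ - (m : ℂ) • α)).re + s * ‖(t : ℂ) • ζ - (m : ℂ) • α‖ ^ 2 =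
      2 * (inner ℂ α ((t : ℂ) • α - (m : ℂ) • ζ)).re + s * ‖(t : ℂ) • α - (m : ℂ) • ζ‖ ^ 2 := by
  have key : ∀ x y : H, 2 * (inner ℂ x ((t : ℂ) • x - (m : ℂ) • y)).re +
      s * ‖(t : ℂ) • x - (m : ℂ) • y‖ ^ 2 =
      (2 * t + s * t ^ 2) * ‖x‖ ^ 2 + s * m ^ 2 * ‖y‖ ^ 2 -
        (2 * m + 2 * s * t * m) * (inner ℂ x y).re := by
    intro x y
    have h := norm_sub_sq (𝕜 := ℂ) ((t : ℂ) • x) ((m : ℂ) • y)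
    rw [h, inner_sub_right, inner_smul_right, inner_smul_right, inner_smul_left, inner_smul_right,
      norm_smul, norm_smul, inner_self_eq_norm_sq_to_K]
    simp only [Complex.conj_ofReal, RCLike.re_to_complex, Complex.re_ofReal_mul, Complex.sub_re,
      Complex.norm_real, mul_pow, Real.norm_eq_abs, sq_abs, Complex.coe_algebraMap, ← Complex.ofReal_pow,
      Complex.ofReal_re]
    ring
  have hcoef : 2 * t + s * t ^ 2 = s * m ^ 2 := by
    apply mul_left_cancel₀ hs0
    rw [hm] at hs ⊢
    linear_combination hs
  have hsymm : (inner ℂ α ζ).re = (inner ℂ ζ α).re := inner_re_symm (𝕜 := ℂ) α ζ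
  rw [key, key, hcoef, hsymm]
  ring

variable {R : Type*} [CommRing R] [IsDomain R] [Algebra ℂ R] [Module R H] [IsScalarTower ℂ R H]
variable [DecidableEq n]

theorem norm_reflected_smul_le_of_sum_lt_one {z : n → R} (hz : ∀ i, z i ≠ 0)
    (hzH : ∀ i (h : H), ‖z i • h‖ ≤ ‖h‖) {a : n → ℂ} (ha : ∑ i, ‖a i‖ < 1) (h : H) :
    ‖(∏ i, z i - ∑ i, algebraMap ℂ R (conj (a i)) * ∏ j ∈ univ.erase i, z j) • h‖ ≤
      ‖(1 - ∑ i, algebraMap ℂ R (a i) * z i) • h‖ := by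
  have hroot : ∀ i, ∃ u : ℂ, u ^ 2 = a i := fun i => IsAlgClosed.exists_pow_nat_eq _ two_pos
  choose u hu using hroot
  have hnu : ∀ i, ‖u i‖ ^ 2 = ‖a i‖ := fun i => by rw [← norm_pow, hu]
  set s : ℝ := ∑ i, ‖a i‖ with hs
  have hsu : ∑ i, ‖u i‖ ^ 2 = s := by simp only [hnu, hs]
  have hs_nonneg : 0 ≤ s := Finset.sum_nonneg fun i _ => norm_nonneg _
  rcases hs_nonneg.eq_or_lt with hs0 | hs0
  -- Here `t` below would divide by zero, but the claim is just that `∏ zᵢ` is a contraction.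
  · have ha0 : ∀ i, a i = 0 := fun i => norm_eq_zero.1
      ((Finset.sum_eq_zero_iff_of_nonneg fun i _ => norm_nonneg (a i)).1 (hs ▸ hs0.symm) i
        (mem_univ i))
    simp only [ha0, map_zero, zero_mul, Finset.sum_const_zero, sub_zero, one_smul]
    clear_value s
    induction (univ : Finset n) using Finset.induction_on with
    | empty => simp
    | insert i t hi ih => rw [Finset.prod_insert hi, mul_smul]; exact (hzH _ _).trans ih
  have hpos : 0 < 1 - s ^ 2 := by nlinarith
  -- `m` is the eigenvalue of `(1 - KK*)^(-1/2)` on the line of `ū`, and `t` is chosen so that this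
  -- operator is `1 + t ū uᵀ`.
  set m : ℝ := 1 / √(1 - s ^ 2) with hm_def
  have hm_pos : 0 < m := by positivity
  have hm : m ^ 2 * (1 - s ^ 2) = 1 := by
    rw [hm_def, div_pow, Real.sq_sqrt hpos.le]
    field_simp
  set t : ℝ := (m - 1) / s with ht_def
  have hmt : m = 1 + t * s := by rw [ht_def]; field_simp; ring
  let κ : ℂ →+* R := algebraMap ℂ R
  have hκ : ∀ (c : ℂ) (x : H), κ c • x = c • x := fun c x => algebraMap_smul R c x
  let b : n → R := fun j => κ t * (κ (u j) * z j) - κ m * κ (conj (u j))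
  let c : n → R := fun j => κ t * κ (conj (u j)) - κ m * (κ (u j) * z j)
  have hdom := norm_det_smul_le (H := H)
    (B := Matrix.diagonal z + Matrix.vecMulVec (fun i => κ (conj (u i))) b)
    (C := Matrix.diagonal (fun _ => 1) + Matrix.vecMulVec (fun i => κ (u i)) c) ?_ h
  · have hmt' : κ m = 1 + κ t * κ s := by
      rw [← map_mul, ← map_one κ, ← map_add, hmt]; push_cast; rfl
    have hcu : ∀ i, κ (conj (u i)) * κ (u i) = κ (‖a i‖ : ℂ) := fun i => by
      rw [← map_mul, ← hnu, mul_comm, Complex.mul_conj']; push_cast; rfl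
    have hκs : κ (s : ℂ) = ∑ i, κ (‖a i‖ : ℂ) := by
      rw [hs]; push_cast; rw [map_sum]
    have hsplit : ∀ P : R, κ m * P = P + ∑ i, κ t * κ (‖a i‖ : ℂ) * P := fun P => by
      rw [hmt', hκs, add_mul, one_mul, Finset.mul_sum, Finset.sum_mul]
    have e1 : (Matrix.diagonal z + Matrix.vecMulVec (fun i => κ (conj (u i))) b).det =
        κ m * (∏ i, z i - ∑ i, κ (conj (a i)) * ∏ j ∈ univ.erase i, z j) := by
      rw [det_diagonal_add_vecMulVec _ _ _ hz, mul_sub, Finset.mul_sum, hsplit, add_sub_assoc, ← Finset.sum_sub_distrib]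
      congr 1
      refine Finset.sum_congr rfl fun i _ => ?_
      rw [← Finset.mul_prod_erase univ z (mem_univ i), ← hcu, ← hu, map_pow, map_pow]
      simp only [b]
      ring
    have e2 : (Matrix.diagonal (fun _ => 1) + Matrix.vecMulVec (fun i => κ (u i)) c).det =
        κ m * (1 - ∑ i, κ (a i) * z i) := by
      rw [det_diagonal_add_vecMulVec _ _ _ (fun _ => one_ne_zero), mul_sub, Finset.mul_sum, hsplit,
        add_sub_assoc, ← Finset.sum_sub_distrib]
      simp only [Finset.prod_const_one, mul_one]
      congr 1
      refine Finset.sum_congr rfl fun i _ => ?_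
      rw [← hcu, ← hu, map_pow]
      simp only [c]
      ring
    rw [e1, e2, mul_smul, mul_smul, hκ, hκ, norm_smul (m : ℂ), norm_smul (m : ℂ)] at hdom
    refine le_of_mul_le_mul_left hdom ?_
    rw [Complex.norm_real]
    exact norm_pos_iff.2 hm_pos.ne'
  -- The cross terms of `‖By‖²` and `‖Cy‖²` agree by the swap identity, leaving `∑‖zᵢyᵢ‖² ≤ ∑‖yᵢ‖²`.
  · intro y
    let α : H := ∑ j, conj (u j) • y j
    let ζ : H := ∑ j, u j • (z j • y j)
    have hb : ∑ j, b j • y j = (t : ℂ) • ζ - (m : ℂ) • α := by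
      simp only [b, ζ, α, sub_smul, mul_smul, hκ, Finset.sum_sub_distrib, Finset.smul_sum]
    have hc : ∑ j, c j • y j = (t : ℂ) • α - (m : ℂ) • ζ := by
      simp only [c, ζ, α, sub_smul, mul_smul, hκ, Finset.sum_sub_distrib, Finset.smul_sum]
    have hB : ∀ i, ∑ j, (Matrix.diagonal z + Matrix.vecMulVec (fun i => κ (conj (u i))) b : Matrix n n R) i j • y j
        = z i • y i + conj (u i) • ((t : ℂ) • ζ - (m : ℂ) • α) := by
      intro i
      simp only [Matrix.add_apply, add_smul, Matrix.vecMulVec_apply, Finset.sum_add_distrib,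
        mul_smul, hκ, ← Finset.smul_sum, hb, Matrix.diagonal_apply, ite_smul, zero_smul,
        Finset.sum_ite_eq, mem_univ, if_true]
    have hC : ∀ i, ∑ j, (Matrix.diagonal (fun _ => 1) + Matrix.vecMulVec (fun i => κ (u i)) c : Matrix n n R) i j • y j
        = y i + conj (conj (u i)) • ((t : ℂ) • α - (m : ℂ) • ζ) := by
      intro i
      simp only [Matrix.add_apply, add_smul, Matrix.vecMulVec_apply, Finset.sum_add_distrib,
        mul_smul, hκ, ← Finset.smul_sum, hc, Matrix.diagonal_apply, ite_smul, zero_smul,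
        Finset.sum_ite_eq, mem_univ, if_true, one_smul, Complex.conj_conj]
    simp only [hB, hC]
    rw [sum_norm_sq_add_smul, sum_norm_sq_add_smul (fun i => conj (u i))]
    simp only [RCLike.norm_conj, hsu]
    rw [add_assoc, add_assoc, re_inner_add_norm_sq_swap hmt hm hs0.ne' α ζ]
    gcongr with i _
    exact hzH i _

theorem norm_reflected_smul_le {z : n → R} (hz : ∀ i, z i ≠ 0)
    (hzH : ∀ i (h : H), ‖z i • h‖ ≤ ‖h‖) {a : n → ℂ} (ha : ∑ i, ‖a i‖ ≤ 1) (h : H) :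
    ‖(∏ i, z i - ∑ i, algebraMap ℂ R (conj (a i)) * ∏ j ∈ univ.erase i, z j) • h‖ ≤
      ‖(1 - ∑ i, algebraMap ℂ R (a i) * z i) • h‖ := by
  -- Scale `a` by `r < 1` and let `r → 1`; both sides are continuous in `r`.
  have key : ∀ r ∈ Set.Ico (0 : ℝ) 1,
      ‖(∏ i, z i) • h - ∑ i, ((r : ℂ) * conj (a i)) • (∏ j ∈ univ.erase i, z j) • h‖ ≤
        ‖h - ∑ i, ((r : ℂ) * a i) • z i • h‖ := by
    rintro r ⟨hr0, hr1⟩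
    have hr : ∑ i, ‖(r : ℂ) * a i‖ < 1 := by
      simp only [norm_mul, Complex.norm_real, Real.norm_eq_abs, abs_of_nonneg hr0]
      rw [← Finset.mul_sum]
      nlinarith
    have := norm_reflected_smul_le_of_sum_lt_one hz hzH hr h
    simpa only [sub_smul, Finset.sum_smul, mul_smul, algebraMap_smul, one_smul, map_mul,
      Complex.conj_ofReal] using this
  have hcl : ∀ r ∈ closure (Set.Ico (0 : ℝ) 1),
      ‖(∏ i, z i) • h - ∑ i, ((r : ℂ) * conj (a i)) • (∏ j ∈ univ.erase i, z j) • h‖ ≤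
        ‖h - ∑ i, ((r : ℂ) * a i) • z i • h‖ := by
    intro r hr
    refine le_on_closure (f := fun r : ℝ =>
      ‖(∏ i, z i) • h - ∑ i, ((r : ℂ) * conj (a i)) • (∏ j ∈ univ.erase i, z j) • h‖)
      (g := fun r : ℝ => ‖h - ∑ i, ((r : ℂ) * a i) • z i • h‖) key ?_ ?_ hr
    · fun_prop
    · fun_prop
  have h1 := hcl 1 (by rw [closure_Ico zero_ne_one]; simp)
  simpa only [Complex.ofReal_one, one_mul, sub_smul, Finset.sum_smul, mul_smul, algebraMap_smul,
    one_smul] using h1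

end Domination

/-! ### Polynomial functional calculus and convergence of power series. -/

section FunctionalCalculus

/-- Pairwise commuting elements of an algebra admit a polynomial functional calculus. -/
theorem exists_algHom_X_eq {σ 𝔸 : Type*} [Ring 𝔸] [Algebra ℂ 𝔸] (T : σ → 𝔸)
    (hT : ∀ i j, Commute (T i) (T j)) :
    ∃ φ : MvPolynomial σ ℂ →ₐ[ℂ] 𝔸, ∀ i, φ (MvPolynomial.X i) = T i := by
  have hcomm : IsMulCommutative (Algebra.adjoin ℂ (Set.range T)) := by
    refine Algebra.isMulCommutative_adjoin ℂ ?_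
    rintro _ ⟨i, rfl⟩ _ ⟨j, rfl⟩
    exact hT i j
  open scoped IsMulCommutative in
  refine ⟨(Algebra.adjoin ℂ (Set.range T)).val.comp (MvPolynomial.aeval fun i =>
    (⟨T i, Algebra.subset_adjoin ⟨i, rfl⟩⟩ : Algebra.adjoin ℂ (Set.range T))), fun i => ?_⟩
  simp

theorem summable_prod_pow {d : ℕ} {ρ : Fin d → ℝ} (h0 : ∀ i, 0 ≤ ρ i) (h1 : ∀ i, ρ i < 1) :
    Summable fun r : Fin d →₀ ℕ => ∏ i, ρ i ^ r i := by
  refine summable_of_sum_le (c := ∏ i, (1 - ρ i)⁻¹)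
    (fun r => Finset.prod_nonneg fun i _ => pow_nonneg (h0 i) _) fun s => ?_
  let N : ℕ := s.sup (fun r => univ.sup fun i => r i) + 1
  have hN : ∀ r ∈ s, ∀ i, r i < N := fun r hr i => Nat.lt_succ_of_le
    ((Finset.le_sup (f := fun i => r i) (mem_univ i)).trans
      (Finset.le_sup (f := fun r : Fin d →₀ ℕ => univ.sup fun i => r i) hr))
  calc ∑ r ∈ s, ∏ i, ρ i ^ r i
      = ∑ x ∈ s.map Finsupp.equivFunOnFinite.toEmbedding, ∏ i, ρ i ^ x i := by
        rw [Finset.sum_map]; rfl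
    _ ≤ ∑ x ∈ Fintype.piFinset fun _ : Fin d => range N, ∏ i, ρ i ^ x i := by
        refine Finset.sum_le_sum_of_subset_of_nonneg ?_
          fun x _ _ => Finset.prod_nonneg fun i _ => pow_nonneg (h0 i) _
        intro x hx
        obtain ⟨r, hr, rfl⟩ := Finset.mem_map.1 hx
        exact Fintype.mem_piFinset.2 fun i => mem_range.2 (hN r hr i)
    _ = ∏ i, ∑ k ∈ range N, ρ i ^ k := (Finset.prod_univ_sum _ fun i k => ρ i ^ k).symm
    _ ≤ ∏ i, (1 - ρ i)⁻¹ := by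
        refine Finset.prod_le_prod
          (fun i _ => Finset.sum_nonneg fun k _ => pow_nonneg (h0 i) _) fun i _ => ?_
        rw [← tsum_geometric_of_lt_one (h0 i) (h1 i)]
        exact (summable_geometric_of_lt_one (h0 i) (h1 i)).sum_le_tsum _
          fun k _ => pow_nonneg (h0 i) _

variable {d : ℕ} {𝔸 : Type*} [NormedRing 𝔸] [NormedAlgebra ℂ 𝔸] [CompleteSpace 𝔸]

/-- `E` is `g(T)`: bounded coefficients are summed against a product of geometric series, and
multiplying by a monomial merely shifts the index. -/
theorem exists_hasSum_polynomial_mul (φ : MvPolynomial (Fin d) ℂ →ₐ[ℂ] 𝔸) {ρ : Fin d → ℝ}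
    (h0 : ∀ i, 0 ≤ ρ i) (h1 : ∀ i, ρ i < 1)
    (hφ : ∀ r, ‖φ (MvPolynomial.monomial r 1)‖ ≤ ∏ i, ρ i ^ r i)
    (g : MvPowerSeries (Fin d) ℂ) (hg : ∀ r, ‖MvPowerSeries.coeff r g‖ ≤ 1) :
    ∃ E : 𝔸, ∀ P : MvPolynomial (Fin d) ℂ,
      HasSum (fun r => MvPowerSeries.coeff r ((P : MvPowerSeries (Fin d) ℂ) * g) •
        φ (MvPolynomial.monomial r 1)) (φ P * E) := by
  have hs : Summable fun r => MvPowerSeries.coeff r g • φ (MvPolynomial.monomial r 1) := by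
    refine Summable.of_norm_bounded (summable_prod_pow h0 h1) fun r => ?_
    rw [norm_smul]
    exact (mul_le_of_le_one_left (norm_nonneg _) (hg r)).trans (hφ r)
  refine ⟨∑' r, MvPowerSeries.coeff r g • φ (MvPolynomial.monomial r 1), fun P => ?_⟩
  induction P using MvPolynomial.induction_on' with
  | monomial k b =>
    have hinj : Function.Injective fun r : Fin d →₀ ℕ => k + r := add_right_injective k
    rw [← hinj.hasSum_iff]
    · have h := hs.hasSum.mul_left (φ (MvPolynomial.monomial k b))
      refine h.congr_fun ?_
      intro r
      have e : MvPolynomial.monomial k b * MvPolynomial.monomial r (1 : ℂ) =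
          b • MvPolynomial.monomial (k + r) 1 := by
        rw [MvPolynomial.monomial_mul, MvPolynomial.smul_monomial, smul_eq_mul]
      simp only [Function.comp_apply]
      rw [MvPolynomial.coe_monomial, MvPowerSeries.coeff_add_monomial_mul, mul_smul_comm, ← map_mul,
        e, map_smul, smul_smul, mul_comm b]
    · intro r hr
      rw [MvPolynomial.coe_monomial, MvPowerSeries.coeff_monomial_mul, if_neg, zero_smul]
      intro hkr
      exact hr ⟨r - k, add_tsub_cancel_of_le hkr⟩
  | add P Q hP hQ =>
    have h := hP.add hQ
    rw [← add_mul, ← map_add] at h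
    simpa only [MvPolynomial.coe_add, add_mul, map_add, add_smul] using h

end FunctionalCalculus

/-! ### The affine polynomial, its reflection and its inverse series. -/

section Polynomial

variable {d : ℕ} (a : Fin d → ℂ)

/-- The affine polynomial `1 - ∑ aᵢ zᵢ`. -/
def affinePoly : MvPolynomial (Fin d) ℂ := 1 - ∑ i, MvPolynomial.C (a i) * MvPolynomial.X i

open Classical in
/-- The variables occurring in `affinePoly a`, the others being replaced by `1`. -/
def activeVar (i : Fin d) : MvPolynomial (Fin d) ℂ := if a i = 0 then 1 else MvPolynomial.X i

theorem activeVar_ne_zero (i : Fin d) : activeVar a i ≠ 0 := by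
  unfold activeVar
  split_ifs
  · exact one_ne_zero
  · exact MvPolynomial.X_ne_zero i

theorem affinePoly_eq_activeVar :
    affinePoly a = 1 - ∑ i, MvPolynomial.C (a i) * activeVar a i := by
  unfold affinePoly activeVar
  congr 1
  refine Finset.sum_congr rfl fun i _ => ?_
  split_ifs with h <;> simp [h]

theorem coeff_affinePoly (r : Fin d →₀ ℕ) :
    (affinePoly a).coeff r = (if 0 = r then 1 else 0) -
      ∑ i, if Finsupp.single i 1 = r then a i else 0 := by
  classical
  simp only [affinePoly, MvPolynomial.coeff_sub, MvPolynomial.coeff_one, MvPolynomial.coeff_sum,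
    MvPolynomial.coeff_C_mul, MvPolynomial.coeff_X, mul_ite, mul_one, mul_zero]

theorem coeff_affinePoly_zero : (affinePoly a).coeff 0 = 1 := by
  simp [coeff_affinePoly]

theorem coeff_affinePoly_single (i : Fin d) :
    (affinePoly a).coeff (Finsupp.single i 1) = -a i := by
  classical
  have h : ∀ j, (Finsupp.single j 1 = (Finsupp.single i 1 : Fin d →₀ ℕ)) ↔ j = i := fun j =>
    (Finsupp.single_left_injective one_ne_zero).eq_iff
  rw [coeff_affinePoly, if_neg]
  · simp [h]
  · intro h
    simpa using h.symm

theorem support_affinePoly_subset :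
    (affinePoly a).support ⊆ insert 0 (univ.image fun i => Finsupp.single i 1) := by
  classical
  intro r hr
  rw [MvPolynomial.mem_support_iff, coeff_affinePoly] at hr
  by_contra hmem
  simp only [Finset.mem_insert, Finset.mem_image, mem_univ, true_and, not_or, not_exists] at hmem
  apply hr
  rw [if_neg (Ne.symm hmem.1), Finset.sum_eq_zero fun i _ => if_neg (hmem.2 i), sub_zero]

theorem multiDegree_affinePoly (i : Fin d) [Decidable (a i = 0)] :
    multiDegree (affinePoly a) i = if a i = 0 then 0 else 1 := by
  classical
  have hle : ∀ m : ℕ, (a i ≠ 0 → 1 ≤ m) → (affinePoly a).degreeOf i ≤ m := by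
    intro m hm
    rw [MvPolynomial.degreeOf_le_iff]
    intro r hr
    have hr' := support_affinePoly_subset a hr
    simp only [Finset.mem_insert, Finset.mem_image, mem_univ, true_and] at hr'
    rcases hr' with rfl | ⟨j, rfl⟩
    · simp
    · rcases eq_or_ne j i with rfl | hj
      · rw [MvPolynomial.mem_support_iff, coeff_affinePoly_single] at hr
        simpa using hm (neg_ne_zero.1 hr)
      · simp [Finsupp.single_eq_of_ne' hj]
  change (affinePoly a).degreeOf i = _
  split_ifs with h
  · exact Nat.le_zero.1 (hle 0 fun h' => (h' h).elim)
  · refine le_antisymm (hle 1 fun _ => le_rfl) ?_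
    have := MvPolynomial.monomial_le_degreeOf i (f := affinePoly a) (m := Finsupp.single i 1)
      (by rw [MvPolynomial.mem_support_iff, coeff_affinePoly_single]; exact neg_ne_zero.2 h)
    simpa using this

theorem X_pow_multiDegree (i : Fin d) :
    (MvPolynomial.X i : MvPolynomial (Fin d) ℂ) ^ multiDegree (affinePoly a) i = activeVar a i := by
  classical
  rw [multiDegree_affinePoly, activeVar]
  split_ifs <;> simp

theorem monomial_eq_C_mul_prod (r : Fin d →₀ ℕ) (b : ℂ) :
    MvPolynomial.monomial r b = MvPolynomial.C b * ∏ i, MvPolynomial.X i ^ r i := by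
  rw [MvPolynomial.monomial_eq, Finsupp.prod_fintype _ _ (by simp)]

/-- `deg_i p` is 0 when `aᵢ = 0`, so `z^(deg p)` involves only active variables. Substituting 1 for
the others keeps every factor nonzero and contractive, as the determinant argument requires. -/
theorem reflection_affinePoly :
    reflection (multiDegree (affinePoly a)) (affinePoly a) =
      ∏ i, activeVar a i -
        ∑ i, MvPolynomial.C (conj (a i)) * ∏ j ∈ univ.erase i, activeVar a j := by
  classical
  rw [reflection, Finset.sum_subset (support_affinePoly_subset a), Finset.sum_insert,
    Finset.sum_image, coeff_affinePoly_zero, sub_eq_add_neg, ← Finset.sum_neg_distrib]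
  · congr 1
    · rw [monomial_eq_C_mul_prod]
      simp [X_pow_multiDegree]
    · refine Finset.sum_congr rfl fun i _ => ?_
      rw [coeff_affinePoly_single, monomial_eq_C_mul_prod, map_neg, map_neg, neg_mul,
        ← Finset.mul_prod_erase univ _ (mem_univ i)]
      have hi : (multiDegree (affinePoly a) - Finsupp.single i 1 : Fin d →₀ ℕ) i = 0 := by
        rw [Finsupp.tsub_apply, multiDegree_affinePoly]
        split_ifs <;> simp
      rw [hi, pow_zero, one_mul]
      congr 2
      refine Finset.prod_congr rfl fun j hj => ?_
      rw [← X_pow_multiDegree, Finsupp.tsub_apply,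
        Finsupp.single_eq_of_ne (Finset.ne_of_mem_erase hj), tsub_zero]
  · exact fun i _ j _ hij => Finsupp.single_left_injective one_ne_zero hij
  · simp
  · intro r _ hr
    rw [MvPolynomial.notMem_support_iff.1 hr, map_zero, map_zero]

/-- The power series of `1 / (1 - ∑ aᵢ zᵢ)`. -/
def affineInv : MvPowerSeries (Fin d) ℂ := (affinePoly a : MvPowerSeries (Fin d) ℂ)⁻¹

theorem affinePoly_mul_affineInv :
    (affinePoly a : MvPowerSeries (Fin d) ℂ) * affineInv a = 1 := by
  refine MvPowerSeries.mul_inv_cancel _ ?_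
  rw [← MvPowerSeries.coeff_zero_eq_constantCoeff_apply, MvPolynomial.coeff_coe,
    coeff_affinePoly_zero]
  exact one_ne_zero

/-- For `r ≠ 0` the identity `p · (1/p) = 1` reads `c_r = ∑ aᵢ c_(r-eᵢ)`, over the `i` with `rᵢ >
0`; induct on total degree. -/
theorem norm_coeff_affineInv_le (ha : ∑ i, ‖a i‖ ≤ 1) (r : Fin d →₀ ℕ) :
    ‖MvPowerSeries.coeff r (affineInv a)‖ ≤ 1 := by
  classical
  have hrec : ∀ r : Fin d →₀ ℕ, MvPowerSeries.coeff r (affineInv a) =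
      (if r = 0 then 1 else 0) + ∑ i, if Finsupp.single i 1 ≤ r then
        a i * MvPowerSeries.coeff (r - Finsupp.single i 1) (affineInv a) else 0 := by
    intro r
    have hp : (affinePoly a : MvPowerSeries (Fin d) ℂ) =
        1 - ∑ i, MvPowerSeries.monomial (Finsupp.single i 1) (a i) := by
      ext r
      simp only [MvPolynomial.coeff_coe, coeff_affinePoly, map_sub, map_sum, MvPowerSeries.coeff_one,
        MvPowerSeries.coeff_monomial, eq_comm]
    have h := congrArg (MvPowerSeries.coeff r) (affinePoly_mul_affineInv a)
    rw [hp, sub_mul, one_mul, Finset.sum_mul, map_sub, map_sum, MvPowerSeries.coeff_one] at h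
    simp only [MvPowerSeries.coeff_monomial_mul] at h
    exact sub_eq_iff_eq_add.1 h
  induction hn : r.degree using Nat.strong_induction_on generalizing r with
  | _ n ih =>
    rw [hrec]
    split_ifs with h0
    · subst h0
      simp
    · rw [zero_add]
      refine (norm_sum_le _ _).trans (le_trans (Finset.sum_le_sum fun i _ => ?_) ha)
      split_ifs with hi
      · rw [norm_mul]
        refine mul_le_of_le_one_right (norm_nonneg _) (ih _ ?_ _ rfl)
        rw [← hn]
        conv_rhs => rw [← tsub_add_cancel_of_le hi, map_add]
        simp
      · simp

end Polynomial

/-! ### Evaluation at operators and the Schur–Agler bound. -/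

section SchurAgler

variable {d : ℕ}

theorem opMonomial_eq {H : Type*} [NormedAddCommGroup H] [InnerProductSpace ℂ H]
    {T : Fin d → H →L[ℂ] H} {φ : MvPolynomial (Fin d) ℂ →ₐ[ℂ] (H →L[ℂ] H)}
    (hφ : ∀ i, φ (MvPolynomial.X i) = T i) (r : Fin d →₀ ℕ) :
    opMonomial T r = φ (MvPolynomial.monomial r 1) := by
  rw [monomial_eq_C_mul_prod, map_one, one_mul, ← List.prod_ofFn, map_list_prod, List.map_ofFn,
    opMonomial]
  congr 2
  ext1 i
  simp [hφ]

theorem norm_list_prod_ofFn_le {d : ℕ} {H : Type*} [NormedAddCommGroup H] [InnerProductSpace ℂ H]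
    (T : Fin d → H →L[ℂ] H) : ‖(List.ofFn T).prod‖ ≤ ∏ i, ‖T i‖ := by
  induction d with
  | zero =>
    rw [List.ofFn_zero, List.prod_nil, Fin.prod_univ_zero]
    exact ContinuousLinearMap.norm_id_le
  | succ d ih =>
    rw [List.ofFn_succ, List.prod_cons, Fin.prod_univ_succ]
    exact (norm_mul_le _ _).trans (mul_le_mul_of_nonneg_left (ih _) (norm_nonneg _))

theorem norm_opMonomial_le {H : Type*} [NormedAddCommGroup H] [InnerProductSpace ℂ H]
    (T : Fin d → H →L[ℂ] H) (r : Fin d →₀ ℕ) : ‖opMonomial T r‖ ≤ ∏ i, ‖T i‖ ^ r i := by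
  refine (norm_list_prod_ofFn_le _).trans
    (Finset.prod_le_prod (fun i _ => norm_nonneg _) fun i _ => ?_)
  rcases Nat.eq_zero_or_pos (r i) with h | h
  -- `H` may be trivial, so the identity only has norm at most 1.
  · rw [h, pow_zero, pow_zero]
    exact ContinuousLinearMap.norm_id_le
  · exact norm_pow_le' _ h

theorem norm_reflection_apply_le {H : Type*} [NormedAddCommGroup H] [InnerProductSpace ℂ H]
    (φ : MvPolynomial (Fin d) ℂ →ₐ[ℂ] (H →L[ℂ] H)) (hφ : ∀ i, ‖φ (MvPolynomial.X i)‖ ≤ 1)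
    {a : Fin d → ℂ} (ha : ∑ i, ‖a i‖ ≤ 1) (h : H) :
    ‖φ (reflection (multiDegree (affinePoly a)) (affinePoly a)) h‖ ≤ ‖φ (affinePoly a) h‖ := by
  -- The operators generated by `T` need not form a domain, so the determinants live in the
  -- polynomial ring, acting on `H` through `φ`.
  let inst : Module (MvPolynomial (Fin d) ℂ) H := Module.compHom H φ.toRingHom
  have hsmul : ∀ (P : MvPolynomial (Fin d) ℂ) (x : H), P • x = φ P x := fun _ _ => rfl
  have tower : IsScalarTower ℂ (MvPolynomial (Fin d) ℂ) H :=
    ⟨fun c P x => by rw [hsmul, hsmul, map_smul]; rfl⟩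
  have hz : ∀ i (x : H), ‖activeVar a i • x‖ ≤ ‖x‖ := by
    intro i x
    unfold activeVar
    split_ifs
    · rw [one_smul]
    · rw [hsmul]
      exact ((φ (MvPolynomial.X i)).le_opNorm x).trans
        (mul_le_of_le_one_left (norm_nonneg _) (hφ i))
  have key := norm_reflected_smul_le (activeVar_ne_zero a) hz ha h
  rwa [MvPolynomial.algebraMap_eq, ← reflection_affinePoly, ← affinePoly_eq_activeVar] at key

/-- The power series of `z ↦ z^(deg p) p̄(1/z) / p(z)` for `p = 1 - ∑ aᵢ zᵢ`. -/
def aglerSeries (a : Fin d → ℂ) : MvPowerSeries (Fin d) ℂ :=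
  (reflection (multiDegree (affinePoly a)) (affinePoly a) : MvPolynomial (Fin d) ℂ) * affineInv a

theorem hasSum_aglerSeries {𝔸 : Type*} [NormedRing 𝔸] [NormedAlgebra ℂ 𝔸] [CompleteSpace 𝔸]
    (φ : MvPolynomial (Fin d) ℂ →ₐ[ℂ] 𝔸) {ρ : Fin d → ℝ}
    (h0 : ∀ i, 0 ≤ ρ i) (h1 : ∀ i, ρ i < 1)
    (hφ : ∀ r, ‖φ (MvPolynomial.monomial r 1)‖ ≤ ∏ i, ρ i ^ r i)
    {a : Fin d → ℂ} (ha : ∑ i, ‖a i‖ ≤ 1) :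
    ∃ E : 𝔸, φ (affinePoly a) * E = 1 ∧
      HasSum (fun r => MvPowerSeries.coeff r (aglerSeries a) • φ (MvPolynomial.monomial r 1))
        (φ (reflection (multiDegree (affinePoly a)) (affinePoly a)) * E) := by
  classical
  obtain ⟨E, hE⟩ := exists_hasSum_polynomial_mul φ h0 h1 hφ _ (norm_coeff_affineInv_le a ha)
  refine ⟨E, ?_, hE _⟩
  have h := hE (affinePoly a)
  rw [affinePoly_mul_affineInv] at h
  refine h.unique ?_
  convert hasSum_single (0 : Fin d →₀ ℕ) _ using 1
  · rw [MvPowerSeries.coeff_zero_one, one_smul, ← MvPolynomial.one_def, map_one]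
  · intro r hr
    rw [MvPowerSeries.coeff_one, if_neg hr, zero_smul]

/-- The case `𝔸 = ℂ` of the calculus; it yields both semi-stability and the scalar power series. -/
theorem exists_eval_mul_eq_one {a : Fin d → ℂ} (ha : ∑ i, ‖a i‖ ≤ 1) {z : Fin d → ℂ}
    (hz : z ∈ polydisk d) :
    ∃ E : ℂ, MvPolynomial.eval z (affinePoly a) * E = 1 ∧
      HasSum (fun r : Fin d →₀ ℕ => MvPowerSeries.coeff r (aglerSeries a) * ∏ i, z i ^ r i)
        (MvPolynomial.eval z (reflection (multiDegree (affinePoly a)) (affinePoly a)) * E) := by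
  have hmon : ∀ r : Fin d →₀ ℕ,
      MvPolynomial.aeval z (MvPolynomial.monomial r (1 : ℂ)) = ∏ i, z i ^ r i := fun r => by
    simp [monomial_eq_C_mul_prod]
  have h := hasSum_aglerSeries (MvPolynomial.aeval z) (fun i => norm_nonneg (z i)) hz
    (fun r => by rw [hmon, norm_prod]; simp) ha
  simpa only [hmon, smul_eq_mul, MvPolynomial.aeval_eq_eval] using h

theorem isAglerDenominator_affinePoly {a : Fin d → ℂ} (ha : ∑ i, ‖a i‖ ≤ 1) :
    IsAglerDenominator.{u} (affinePoly a) := by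
  have hstable : IsSemiStable (affinePoly a) := fun z hz => by
    obtain ⟨E, hE, -⟩ := exists_eval_mul_eq_one ha hz
    exact left_ne_zero_of_mul_eq_one hE
  refine ⟨hstable, ?_, aglerSeries a, fun z hz => ?_, ?_⟩
  · exact ((AnalyticOnNhd.eval_mvPolynomial _).mono (Set.subset_univ _)).div
      ((AnalyticOnNhd.eval_mvPolynomial _).mono (Set.subset_univ _)) hstable
  · obtain ⟨E, hE, hsum⟩ := exists_eval_mul_eq_one ha hz
    simp only
    rwa [div_eq_mul_inv, ← eq_inv_of_mul_eq_one_right hE]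
  · intro H _ _ _ T hcomm hT
    obtain ⟨φ, hφ⟩ := exists_algHom_X_eq T hcomm
    obtain ⟨E, hE, hsum⟩ := hasSum_aglerSeries φ (fun i => norm_nonneg (T i)) hT
      (fun r => by rw [← opMonomial_eq hφ]; exact norm_opMonomial_le T r) ha
    simp only [← opMonomial_eq hφ] at hsum
    refine ⟨_, hsum, ContinuousLinearMap.opNorm_le_bound _ zero_le_one fun h => ?_⟩
    -- Only a right inverse is needed: at `E h` the upper bound `‖p(T)Eh‖` is `‖h‖`.
    have hle := norm_reflection_apply_le φ (fun i => by rw [hφ]; exact (hT i).le) ha (E h)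
    rw [← mul_apply_eq_comp (φ (affinePoly a)), hE] at hle
    simpa using hle

end SchurAgler

end AglerDen

end

theorem mainTheorem4 (d : ℕ) (a : Fin d → ℂ) (ha : ∑ i, ‖a i‖ ≤ 1) :
    AglerDen.IsAglerDenominator.{u}
      (1 - ∑ i, MvPolynomial.C (a i) * MvPolynomial.X i : MvPolynomial (Fin d) ℂ) :=
  AglerDen.isAglerDenominator_affinePoly ha
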